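/- Let $k\ge 0$ be an integer, let $\mathbf{F}_k$ be the free group on $x_1,\dots,x_k$, and let $w\in\mathbf{F}_k$ be a non-trivial word. For a group $G$ let $w(G)\subseteq G$ be the image of the word map $G^k\to G$ which sends $(g_1,\dots,g_k)$ to the value at $w$ of the homomorphism $\mathbf{F}_k\to G$ with $x_i\mapsto g_i$. For permutations $\sigma,\tau$ in the symmetric group ${\rm S}_n$ on $n$ points, let $d_{\rm H}(\sigma,\tau)=\frac1n\,|\{x : \sigma(x)\neq\tau(x)\}|$ be the normalized Hamming distance, and for a nonempty set $Y\subseteq{\rm S}_n$ write $d_{\rm H}(\sigma,Y)=\inf_{\tau\in Y}d_{\rm H}(\sigma,\tau)$. (i) For every $\varepsilon>0$ there is an integer $N=N(\varepsilon,w)$ such that for all $n\ge N$ the word image $w({\rm S}_n)$ is $\varepsilon$-dense in ${\rm S}_n$, i.e. $d_{\rm H}(\sigma,w({\rm S}_n))\le\varepsilon$ for all $\sigma\in{\rm S}_n$. (ii) There are real constants $e=e(w)\ge 1$ and $C=C(w)>0$, depending only on $w$, such that $d_{\rm H}(\sigma,w({\rm S}_n))\le C\,n^{-1/e}$ for all integers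 $n\ge 1$ and all $\sigma\in{\rm S}_n$. -/

import Mathlib

/-- The word map of `w ∈ F_k` on a group `G`: the value at `w` of the homomorphism
`F_k → G` sending the `i`-th free generator to `g i`. -/
def wordMap {k : ℕ} (w : FreeGroup (Fin k)) (G : Type*) [Group G] (g : Fin k → G) : G :=
  FreeGroup.lift g w

/-- The word image `w(G)`. -/
def wordImage {k : ℕ} (w : FreeGroup (Fin k)) (G : Type*) [Group G] : Set G :=
  Set.range (wordMap w G)

/-- The normalized Hamming distance on `S_n`: the proportion of points at which two
permutations differ. -/
noncomputable def normHammingDist {n : ℕ} (σ τ : Equiv.Perm (Fin n)) : ℝ :=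
  (hammingDist (fun x => σ x) (fun x => τ x) : ℝ) / (n : ℝ)

/-- The distance `inf_{y ∈ Y} d(x, y)` from a point to a (nonempty) set, for a
nonnegative distance function `d`. -/
noncomputable def distToSet {X : Type*} (d : X → X → ℝ) (x : X) (Y : Set X) : ℝ :=
  ⨅ y : Y, d x y

/-- `Y` is `ε`-dense with respect to `d`: every point is at distance at most `ε` from `Y`. -/
def IsEpsDense {X : Type*} (d : X → X → ℝ) (ε : ℝ) (Y : Set X) : Prop :=
  ∀ x : X, distToSet d x Y ≤ ε

/-- Word images are nonempty, so the infimum in `distToSet` is taken over a nonempty set. -/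
theorem wordImage_nonempty {k : ℕ} (w : FreeGroup (Fin k)) (G : Type*) [Group G] :
    (wordImage w G).Nonempty :=
  Set.range_nonempty _

/-- The normalized Hamming distance is nonnegative, so the infimum in `distToSet` is taken
over a set that is bounded below. -/
theorem normHammingDist_nonneg {n : ℕ} (σ τ : Equiv.Perm (Fin n)) :
    0 ≤ normHammingDist σ τ :=
  div_nonneg (Nat.cast_nonneg _) (Nat.cast_nonneg _)

/-! It suffices to let `w` act on some finite set with all cycles of a prescribed length `m`, the
size of the set being polynomial in `m`. Given this (`exists_perm_rep_minimalPeriod`), cut the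
cycles of `σ` down to length at most `L`, which changes a proportion at most `2 / L` of the points
(`Equiv.Perm.exists_minimalPeriod_le`). Then, for each `m ≤ L`, fill the points on `m`-cycles with
copies of that action until too few are left (`exists_perm_rep_close`). The leftovers number at most
a polynomial in `L`, and taking `L` to be a small power of `n` gives the rate.

The actions come from a unipotent integral representation in which `w` is non-trivial. If `b` is the
first index whose basis vector `w` moves, then `w` translates the affine slice at `b` by a fixed
non-zero integer vector `t`. With `a` the gcd of the entries of `t`, this translation modulo `m * a`
has all cycles of length exactly `m`. -/

/-! ### Unipotent representations of free groups -/

/-- The nilpotent operator `v ↦ (k ↦ v (k + 1))` restricted to the positions labelled `i`. -/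
def labelShift {α : Type*} [DecidableEq α] (R : Type*) [CommRing R] (l : ℕ → Option α) (i : α) :
    (ℕ → R) →ₗ[R] (ℕ → R) where
  toFun v k := if l k = some i then v (k + 1) else 0
  map_add' u v := by ext k; by_cases h : l k = some i <;> simp [h]
  map_smul' c v := by ext k; by_cases h : l k = some i <;> simp [h]

/-- Adjacent positions carry different labels. -/
def IsAlternating {α : Type*} (l : ℕ → Option α) : Prop :=
  ∀ k i, l k = some i → l (k + 1) ≠ some i

section PathRep

variable {α : Type*} [DecidableEq α] {R : Type*} [CommRing R] {l : ℕ → Option α}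

theorem labelShift_apply (i : α) (v : ℕ → R) (k : ℕ) :
    labelShift R l i v k = if l k = some i then v (k + 1) else 0 := rfl

/-- Neighbouring positions never share a label, so no two shifts with the same label compose. Hence
`1 + N` has inverse `1 - N`, and its powers are linear in the exponent. -/
theorem labelShift_labelShift (hl : IsAlternating l) (i : α) (v : ℕ → R) :
    labelShift R l i (labelShift R l i v) = 0 := by
  ext k
  by_cases h : l k = some i
  · simp [labelShift_apply, hl k i h]
  · simp [labelShift_apply, h]

/-- The automorphism `1 + labelShift`. -/
def labelShear (R : Type*) [CommRing R] (hl : IsAlternating l) (i : α) :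
    (ℕ → R) ≃ₗ[R] (ℕ → R) :=
  LinearEquiv.ofLinearMap (LinearMap.id + labelShift R l i) (LinearMap.id - labelShift R l i)
    (LinearMap.ext fun v => by simp [labelShift_labelShift hl])
    (LinearMap.ext fun v => by simp [labelShift_labelShift hl])

theorem labelShear_apply (hl : IsAlternating l) (i : α) (v : ℕ → R) :
    labelShear R hl i v = v + labelShift R l i v := rfl

theorem labelShear_inv_apply (hl : IsAlternating l) (i : α) (v : ℕ → R) :
    (labelShear R hl i)⁻¹ v = v - labelShift R l i v := rfl

theorem labelShear_zpow_apply (hl : IsAlternating l) (i : α) (e : ℤ) (v : ℕ → R) :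
    (labelShear R hl i ^ e) v = v + e • labelShift R l i v := by
  induction e using Int.induction_on with
  | zero => simp
  | succ n ih =>
    rw [zpow_add_one, (Commute.zpow_self _ _).eq, LinearEquiv.mul_apply, ih, labelShear_apply,
      map_add, map_zsmul, labelShift_labelShift hl]
    module
  | pred n ih =>
    rw [zpow_sub_one, ((Commute.refl _).zpow_left _).inv_right.eq, LinearEquiv.mul_apply, ih,
      labelShear_inv_apply, map_add, map_zsmul, labelShift_labelShift hl]
    module

/-- The representation of the free group in which the generator `i` acts as `labelShear i`. -/
def pathRep (R : Type*) [CommRing R] (hl : IsAlternating l) :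
    FreeGroup α →* ((ℕ → R) ≃ₗ[R] (ℕ → R)) :=
  FreeGroup.lift (labelShear R hl)

/-- Base change: the shears have integer coefficients, so what `w` does over `ℤ` determines what it
does over every `ZMod`. -/
theorem pathRep_comp {S : Type*} [CommRing S] (hl : IsAlternating l) (f : R →+* S)
    (w : FreeGroup α) (v : ℕ → R) :
    pathRep S hl w (f ∘ v) = f ∘ pathRep R hl w v := by
  induction w using FreeGroup.induction_on generalizing v with
  | C1 => simp
  | of i =>
    ext k
    by_cases h : l k = some i <;> simp [pathRep, labelShear_apply, labelShift_apply, h]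
  | inv_of i _ =>
    ext k
    by_cases h : l k = some i <;> simp [pathRep, labelShear_inv_apply, labelShift_apply, h]
  | mul x y hx hy => simp [hx, hy]

/-- The shears are unitriangular: each entry is modified only by the next one. This is what makes
the affine slices invariant. -/
theorem pathRep_apply_of_le (hl : IsAlternating l) (w : FreeGroup α) (b : ℕ) (v : ℕ → R)
    (hv : ∀ k, b < k → v k = 0) (k : ℕ) (hk : b ≤ k) : pathRep R hl w v k = v k := by
  induction w using FreeGroup.induction_on generalizing v k with
  | C1 => simp
  | of i => simp [pathRep, labelShear_apply, labelShift_apply, hv (k + 1) (by omega)]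
  | inv_of i _ => simp [pathRep, labelShear_inv_apply, labelShift_apply, hv (k + 1) (by omega)]
  | mul x y hx hy =>
    rw [map_mul, LinearEquiv.mul_apply, hx _ _ _ hk, hy v hv k hk]
    intro j hj
    rw [hy v hv j hj.le, hv j hj]

end PathRep

/-- Every element of a free group is a product of syllables. -/
theorem FreeGroup.exists_syllables {α : Type*} [DecidableEq α] (w : FreeGroup α) :
    ∃ L : List (α × ℤ), L.IsChain (fun p q => p.1 ≠ q.1) ∧ (∀ p ∈ L, p.2 ≠ 0) ∧
      (L.map fun p => FreeGroup.of p.1 ^ p.2).prod = w := by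
  -- Normal form in the free product of infinite cyclic groups: adjacent letters lie in different
  -- factors and no letter is trivial.
  set W := Monoid.CoprodI.Word.equiv (freeGroupEquivCoprodI w) with hW
  refine ⟨W.toList.map fun s => (s.1, FreeGroup.freeGroupUnitEquivInt s.2), ?_, ?_, ?_⟩
  · rw [List.isChain_map]
    exact W.chain_ne
  · intro p hp
    obtain ⟨s, hs, rfl⟩ := List.mem_map.1 hp
    intro h
    apply W.ne_one s hs
    apply FreeGroup.freeGroupUnitEquivInt.injective
    rw [show FreeGroup.freeGroupUnitEquivInt s.2 = 0 from h]
    simp [FreeGroup.freeGroupUnitEquivInt]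
  · apply freeGroupEquivCoprodI.injective
    have h1 : W.prod = freeGroupEquivCoprodI w := Monoid.CoprodI.Word.equiv.symm_apply_apply _
    rw [← h1, Monoid.CoprodI.Word.prod, map_list_prod, List.map_map, List.map_map]
    congr 1
    apply List.map_congr_left
    intro s _
    have h2 : s.2 = FreeGroup.of () ^ (FreeGroup.freeGroupUnitEquivInt s.2) :=
      (FreeGroup.freeGroupUnitEquivInt.symm_apply_apply s.2).symm
    conv_rhs => rw [h2]
    simp [map_zpow]

section PathRep

variable {α : Type*} [DecidableEq α] {R : Type*} [CommRing R] {l : ℕ → Option α}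

/-- When the positions are labelled by the syllables in order, each syllable, starting from the
last, lowers the first non-zero position by one and multiplies the entry there by its exponent.
These exponents are non-zero integers, so the entry survives. -/
theorem pathRep_syllables_apply (hl : IsAlternating l) (L : List (α × ℤ)) (t : ℕ)
    (hL : ∀ j, ∀ h : j < L.length, l (t + j) = some L[j].1) (h0 : ∀ p ∈ L, p.2 ≠ 0) (v : ℕ → ℤ)
    (hv : ∀ k < t + L.length, v k = 0) (hv' : v (t + L.length) ≠ 0) :
    (∀ k < t, pathRep ℤ hl (L.map fun p => FreeGroup.of p.1 ^ p.2).prod v k = 0) ∧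
      pathRep ℤ hl (L.map fun p => FreeGroup.of p.1 ^ p.2).prod v t ≠ 0 := by
  induction L generalizing t with
  | nil => simpa using ⟨hv, hv'⟩
  | cons p L ih =>
    obtain ⟨h1, h2⟩ := ih (t + 1)
      (fun j hj => by
        have := hL (j + 1) (by simpa using hj)
        rwa [show t + 1 + j = t + (j + 1) by ring])
      (fun q hq => h0 q (List.mem_cons_of_mem _ hq))
      (fun k hk => hv k (by simp only [List.length_cons]; omega))
      (by simpa [add_assoc, add_comm 1] using hv')
    have key : ∀ u : ℕ → ℤ, pathRep ℤ hl (FreeGroup.of p.1 ^ p.2) u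
        = u + p.2 • labelShift ℤ l p.1 u := fun u => by
      rw [map_zpow, ← labelShear_zpow_apply hl]
      simp [pathRep]
    have hp : l t = some p.1 := hL 0 (by simp)
    have hp0 := h0 p (List.mem_cons_self ..)
    rw [List.map_cons, List.prod_cons, map_mul, LinearEquiv.mul_apply, key]
    refine ⟨fun k hk => ?_, ?_⟩
    · simp [labelShift_apply, h1 k (by omega), h1 (k + 1) (by omega)]
    · simp only [Pi.add_apply, Pi.smul_apply, labelShift_apply, hp, h1 t (by omega)]
      simpa using ⟨hp0, h2⟩

end PathRep

theorem exists_pathRep_ne {α : Type*} [DecidableEq α] {w : FreeGroup α} (hw : w ≠ 1) :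
    ∃ (l : ℕ → Option α) (hl : IsAlternating l) (s : ℕ),
      pathRep ℤ hl w (Pi.single s 1) ≠ Pi.single s 1 := by
  obtain ⟨L, hc, h0, rfl⟩ := FreeGroup.exists_syllables w
  have hlen : 0 < L.length := by
    rcases L with _ | ⟨p, L⟩
    · simp at hw
    · simp
  have hl : IsAlternating fun k => L[k]?.map Prod.fst := by
    intro k i h h'
    simp only [Option.map_eq_some_iff] at h h'
    obtain ⟨p, hp, rfl⟩ := h
    obtain ⟨q, hq, hqp⟩ := h'
    obtain ⟨hk, rfl⟩ := List.getElem?_eq_some_iff.1 hp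
    obtain ⟨hk', rfl⟩ := List.getElem?_eq_some_iff.1 hq
    exact List.isChain_iff_getElem.1 hc k hk' hqp.symm
  refine ⟨_, hl, L.length, fun h => ?_⟩
  have := (pathRep_syllables_apply hl L 0 (fun j hj => by simp [hj]) h0 (Pi.single L.length 1)
    (fun k hk => Pi.single_eq_of_ne (by omega) _) (by simp)).2
  rw [h] at this
  exact this (Pi.single_eq_of_ne hlen.ne _)

/-! ### Affine slices and actions with uniform cycle length -/

/-- The functions supported on `{0, …, b}` with value `1` at `b`. -/
def affineSlice (R : Type*) [CommRing R] (b : ℕ) : Set (ℕ → R) :=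
  {v | v b = 1 ∧ ∀ k, b < k → v k = 0}

theorem affineSlice_injective_restrict (R : Type*) [CommRing R] (b : ℕ) :
    Function.Injective fun (v : affineSlice R b) (k : Fin b) => v.1 k := by
  intro u v h
  ext k
  rcases lt_trichotomy k b with hk | rfl | hk
  · exact congrFun h ⟨k, hk⟩
  · rw [u.2.1, v.2.1]
  · rw [u.2.2 k hk, v.2.2 k hk]

/-- The permutation action of the free group on the affine slice. -/
noncomputable def slicePerm {α : Type*} [DecidableEq α] {l : ℕ → Option α}
    (hl : IsAlternating l) (R : Type*) [CommRing R] (b : ℕ) :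
    FreeGroup α →* Equiv.Perm (affineSlice R b) :=
  MonoidHom.toHomPerm
    { toFun := fun w v => ⟨pathRep R hl w v.1, by
        rw [pathRep_apply_of_le hl w b v.1 v.2.2 b le_rfl, v.2.1], fun k hk => by
        rw [pathRep_apply_of_le hl w b v.1 v.2.2 k hk.le, v.2.2 k hk]⟩
      map_one' := funext fun v => Subtype.ext <|
        congrArg (fun g : (ℕ → R) ≃ₗ[R] (ℕ → R) => g v.1) (map_one (pathRep R hl))
      map_mul' := fun x y => funext fun v => Subtype.ext <|
        congrArg (fun g : (ℕ → R) ≃ₗ[R] (ℕ → R) => g v.1) (map_mul (pathRep R hl) x y) }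

theorem slicePerm_apply_coe {α : Type*} [DecidableEq α] {l : ℕ → Option α}
    (hl : IsAlternating l) (R : Type*) [CommRing R] (b : ℕ) (w : FreeGroup α)
    (v : affineSlice R b) : (slicePerm hl R b w v : ℕ → R) = pathRep R hl w v.1 := rfl

theorem pathRep_single_cast {α : Type*} [DecidableEq α] {l : ℕ → Option α}
    (hl : IsAlternating l) (R : Type*) [CommRing R] (w : FreeGroup α) (j : ℕ) :
    pathRep R hl w (Pi.single j 1) =
      fun k => ((pathRep ℤ hl w (Pi.single j 1) k : ℤ) : R) := by
  have h : (Pi.single j 1 : ℕ → R) = Int.castRingHom R ∘ Pi.single j 1 := by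
    ext k
    by_cases hk : k = j
    · subst hk; simp
    · simp [hk]
  rw [h, pathRep_comp]
  rfl

/-- By linearity only the coefficient at `b` contributes to the displacement, since `w` fixes the
earlier basis vectors; on the slice that coefficient is `1`. -/
theorem pathRep_slice_apply {α : Type*} [DecidableEq α] {l : ℕ → Option α}
    (hl : IsAlternating l) (R : Type*) [CommRing R] (w : FreeGroup α) (b : ℕ)
    (hb : ∀ j < b, pathRep ℤ hl w (Pi.single j 1) = Pi.single j 1)
    (v : ℕ → R) (hv : v ∈ affineSlice R b) :
    pathRep R hl w v =
      v + fun k => (((pathRep ℤ hl w (Pi.single b 1) - Pi.single b 1 : ℕ → ℤ) k : ℤ) : R) := by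
  have hv' : v = Pi.single b 1 + ∑ j ∈ Finset.range b, v j • Pi.single j (1 : R) := by
    ext k
    simp only [Pi.add_apply, Finset.sum_apply, Pi.smul_apply, Pi.single_apply, smul_eq_mul,
      mul_ite, mul_one, mul_zero, Finset.sum_ite_eq, Finset.mem_range]
    rcases lt_trichotomy k b with hk | rfl | hk
    · simp [hk, hk.ne]
    · simp [hv.1]
    · simp [hk.ne', hk.not_gt, hv.2 k hk]
  have h1 : ∀ j < b, pathRep R hl w (Pi.single j 1) = Pi.single j 1 := fun j hj => by
    rw [pathRep_single_cast, hb j hj]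
    ext k
    by_cases hk : k = j
    · subst hk; simp
    · simp [hk]
  have h2 : pathRep R hl w (∑ j ∈ Finset.range b, v j • Pi.single j (1 : R)) =
      ∑ j ∈ Finset.range b, v j • Pi.single j (1 : R) := by
    rw [map_sum]
    exact Finset.sum_congr rfl fun j hj => by rw [map_smul, h1 j (Finset.mem_range.1 hj)]
  conv_lhs => rw [hv', map_add, h2, pathRep_single_cast]
  conv_rhs => enter [1]; rw [hv']
  ext k
  by_cases hk : k = b
  · subst hk; simp; ring
  · simp [hk]; ring

/-- A non-trivial element of a free group acts, for every `m`, on some finite set of size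
polynomial in `m` in such a way that all its cycles have length exactly `m`. -/
theorem exists_perm_rep_minimalPeriod {α : Type*} {w : FreeGroup α} (hw : w ≠ 1) :
    ∃ b a : ℕ, 0 < a ∧ ∀ m, 0 < m → ∃ (X : Type) (_ : Fintype X) (_ : Nonempty X)
      (ρ : FreeGroup α →* Equiv.Perm X), Fintype.card X ≤ (m * a) ^ b ∧
        ∀ x, Function.minimalPeriod (ρ w) x = m := by
  classical
  obtain ⟨l, hl, hs⟩ := exists_pathRep_ne hw
  set b := Nat.find hs with hb
  have hbs := Nat.find_spec hs
  rw [← hb] at hbs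
  have hmin : ∀ j < b, pathRep ℤ hl w (Pi.single j 1) = Pi.single j 1 := fun j hj =>
    not_not.1 (Nat.find_min hs hj)
  set t : ℕ → ℤ := pathRep ℤ hl w (Pi.single b 1) - Pi.single b 1 with ht
  have ht0 : ∀ k, b ≤ k → t k = 0 := fun k hk => by
    rw [ht, Pi.sub_apply, pathRep_apply_of_le hl w b _ (fun k hk => by simp [hk.ne']) k hk, sub_self]
  -- The modulus `m * a` is chosen so that `j * t` vanishes exactly when `m * a ∣ j * a`, that is,
  -- when `m ∣ j`.
  set a := (Finset.range b).gcd fun k => (t k).natAbs with ha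
  have ha0 : 0 < a := by
    rw [Nat.pos_iff_ne_zero]
    intro h
    apply sub_ne_zero.2 hbs
    ext k
    rcases lt_or_ge k b with hk | hk
    · exact Int.natAbs_eq_zero.1 (Finset.gcd_eq_zero_iff.1 h k (Finset.mem_range.2 hk))
    · exact ht0 k hk
  refine ⟨b, a, ha0, fun m hm => ?_⟩
  have : NeZero (m * a) := ⟨(Nat.mul_pos hm ha0).ne'⟩
  have hfin := Finite.of_injective _ (affineSlice_injective_restrict (ZMod (m * a)) b)
  refine ⟨affineSlice (ZMod (m * a)) b, Fintype.ofFinite _,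
    ⟨⟨Pi.single b 1, by simp, fun k hk => by simp [hk.ne']⟩⟩, slicePerm hl _ b, ?_, fun x => ?_⟩
  · have := @Fintype.card_le_of_injective _ _ (Fintype.ofFinite _) _ _
      (affineSlice_injective_restrict (ZMod (m * a)) b)
    simpa [ZMod.card] using this
  have hiter : ∀ j : ℕ, (((slicePerm hl (ZMod (m * a)) b w)^[j] x :
      affineSlice (ZMod (m * a)) b) : ℕ → ZMod (m * a)) =
        x.1 + fun k => ((j * t k : ℤ) : ZMod (m * a)) := fun j => by
    induction j with
    | zero => ext k; simp
    | succ j ih =>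
      rw [Function.iterate_succ_apply', slicePerm_apply_coe,
        pathRep_slice_apply hl _ w b hmin _ (Subtype.property _), ih]
      ext k
      simp only [Pi.add_apply]
      push_cast
      ring
  have hper : ∀ j : ℕ, Function.IsPeriodicPt (slicePerm hl (ZMod (m * a)) b w) j x ↔ m ∣ j := by
    intro j
    rw [Function.IsPeriodicPt, Function.IsFixedPt, Subtype.ext_iff, hiter, add_eq_left,
      funext_iff]
    have h1 : (∀ k, ((j * t k : ℤ) : ZMod (m * a)) = 0) ↔
        m * a ∣ (Finset.range b).gcd fun k => j * (t k).natAbs := by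
      rw [Finset.dvd_gcd_iff]
      have h2 : ∀ k, ((j * t k : ℤ) : ZMod (m * a)) = 0 ↔ m * a ∣ j * (t k).natAbs := fun k => by
        rw [ZMod.intCast_zmod_eq_zero_iff_dvd, Int.natCast_dvd, Int.natAbs_mul, Int.natAbs_natCast]
      refine ⟨fun h k _ => (h2 k).1 (h k), fun h k => ?_⟩
      rcases lt_or_ge k b with hk | hk
      · exact (h2 k).2 (h k (Finset.mem_range.2 hk))
      · simp [ht0 k hk]
    refine h1.trans ?_
    rw [Finset.gcd_mul_left, normalize_eq, ← ha]
    exact Nat.mul_dvd_mul_iff_right ha0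
  exact Nat.dvd_antisymm (((hper m).2 dvd_rfl).minimalPeriod_dvd)
    ((hper _).1 (Function.isPeriodicPt_minimalPeriod _ _))

/-! ### Cutting long cycles -/

/-- Cutting long cycles: any permutation agrees with one all of whose cycles have length at most
`L`, except on a set of relative size at most `2 / L`. -/
theorem Equiv.Perm.exists_minimalPeriod_le {Ω : Type*} [Fintype Ω] [DecidableEq Ω] {L : ℕ}
    (hL : 0 < L) (σ : Equiv.Perm Ω) :
    ∃ τ : Equiv.Perm Ω, (∀ x, Function.minimalPeriod τ x ≤ L) ∧
      L * (Finset.univ.filter fun x => σ x ≠ τ x).card ≤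
        2 * (Finset.univ.filter fun x => L < Function.minimalPeriod σ x).card := by
  induction h : (Finset.univ.filter fun x => L < Function.minimalPeriod σ x).card
    using Nat.strong_induction_on generalizing σ with
  | _ M ih =>
  by_cases hx : ∀ x, Function.minimalPeriod σ x ≤ L
  · exact ⟨σ, hx, by simp⟩
  push Not at hx
  obtain ⟨b, hb⟩ := hx
  have hmem : ∀ (π : Equiv.Perm Ω) y, y ∈ Function.periodicPts π := fun π y =>
    π.injective.mem_periodicPts y
  set z : ℕ → Ω := fun j => σ^[j] b with hz
  have hzper : ∀ j, Function.minimalPeriod σ (z j) = Function.minimalPeriod σ b := fun j =>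
    Function.minimalPeriod_apply_iterate (hmem σ b) j
  have hzinj : ∀ i j, i ≤ L → j ≤ L → z i = z j → i = j := fun i j hi hj hij =>
    Function.iterate_injOn_Iio_minimalPeriod (Set.mem_Iio.2 (by omega)) (Set.mem_Iio.2 (by omega))
      hij
  have hzs : ∀ j, σ (z j) = z (j + 1) := fun j => (Function.iterate_succ_apply' σ j b).symm
  -- Since `π (z L) = σ (z 0) = z 1`, the points `z 1, …, z L` split off as a cycle of length `L`,
  -- while `π` differs from `σ` in at most two points.
  set π := σ * Equiv.swap (z L) (z 0) with hπ
  have hπne : ∀ y, y ≠ z L → y ≠ z 0 → π y = σ y := fun y h1 h2 => by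
    rw [hπ, Equiv.Perm.mul_apply, Equiv.swap_apply_of_ne_of_ne h1 h2]
  have hπL : π (z L) = z 1 := by
    rw [hπ, Equiv.Perm.mul_apply, Equiv.swap_apply_left, hzs]
  have hπz : ∀ j < L, π^[j] (z 1) = z (j + 1) := by
    intro j hj
    induction j with
    | zero => rfl
    | succ j ihj =>
      rw [Function.iterate_succ_apply', ihj (by omega), hπne, hzs]
      · exact fun h => by have := hzinj _ _ (by omega) (by omega) h; omega
      · exact fun h => by have := hzinj _ _ (by omega) (by omega) h; omega
  have hper1 : Function.IsPeriodicPt π L (z 1) := by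
    obtain ⟨L, rfl⟩ : ∃ L', L = L' + 1 := ⟨L - 1, by omega⟩
    rw [Function.IsPeriodicPt, Function.IsFixedPt, Function.iterate_succ_apply', hπz L (by omega),
      hπL]
  have hperz : ∀ j < L, Function.minimalPeriod π (z (j + 1)) ≤ L := fun j hj => by
    rw [← hπz j hj]
    exact (hper1.apply_iterate j).minimalPeriod_le hL
  have hshort : ∀ y, Function.minimalPeriod σ y ≤ L → Function.minimalPeriod π y ≤ L := by
    intro y hy
    have hiter : ∀ i, π^[i] y = σ^[i] y := fun i => by
      induction i with
      | zero => rfl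
      | succ i ihi =>
        have hne : ∀ j, σ^[i] y ≠ z j := fun j hj => by
          have := Function.minimalPeriod_apply_iterate (hmem σ y) i
          rw [hj, hzper] at this
          omega
        rw [Function.iterate_succ_apply', ihi, hπne _ (hne _) (hne _),
          Function.iterate_succ_apply']
    refine le_trans (Function.IsPeriodicPt.minimalPeriod_le
      (Function.minimalPeriod_pos_of_mem_periodicPts (hmem σ y)) ?_) hy
    rw [Function.IsPeriodicPt, Function.IsFixedPt, hiter]
    exact Function.isPeriodicPt_minimalPeriod σ y
  -- Short cycles of `σ` avoid the cut one and stay as they are, while `L` long points become short.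
  -- Two changes per `L` points give the factor `2`.
  have hcard : (Finset.univ.filter fun x => L < Function.minimalPeriod π x).card + L ≤ M := by
    have hinj : Set.InjOn (fun j => z (j + 1)) (Finset.range L : Set ℕ) := fun i hi j hj hij => by
      simp only [Finset.coe_range, Set.mem_Iio] at hi hj
      have := hzinj _ _ (by omega) (by omega) hij
      omega
    have hdis : _root_.Disjoint (Finset.univ.filter fun x => L < Function.minimalPeriod π x)
        ((Finset.range L).image fun j => z (j + 1)) := by
      rw [Finset.disjoint_right]
      intro y hy hy'
      obtain ⟨j, hj, rfl⟩ := Finset.mem_image.1 hy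
      have := hperz j (Finset.mem_range.1 hj)
      have := (Finset.mem_filter.1 hy').2
      omega
    rw [← h]
    have himg := Finset.card_image_of_injOn hinj
    rw [Finset.card_range] at himg
    conv_lhs => enter [2]; rw [← himg]
    rw [← Finset.card_union_of_disjoint hdis]
    apply Finset.card_le_card
    intro y hy
    rw [Finset.mem_filter]
    refine ⟨Finset.mem_univ _, ?_⟩
    rcases Finset.mem_union.1 hy with hy | hy
    · by_contra hlt
      have := hshort y (not_lt.1 hlt)
      have := (Finset.mem_filter.1 hy).2
      omega
    · obtain ⟨j, hj, rfl⟩ := Finset.mem_image.1 hy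
      rw [hzper]
      exact hb
  obtain ⟨τ, hτ, hd⟩ := ih _ (by omega) π rfl
  refine ⟨τ, hτ, ?_⟩
  have hsub : (Finset.univ.filter fun x => σ x ≠ τ x) ⊆
      (Finset.univ.filter fun x => π x ≠ τ x) ∪ {z L, z 0} := by
    intro y hy
    simp only [Finset.mem_filter, Finset.mem_univ, true_and, Finset.mem_union, Finset.mem_insert,
      Finset.mem_singleton] at hy ⊢
    by_contra hcon
    push Not at hcon
    exact hy (by rw [← hπne y hcon.2.1 hcon.2.2, hcon.1])
  have hle : (Finset.univ.filter fun x => σ x ≠ τ x).card ≤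
      (Finset.univ.filter fun x => π x ≠ τ x).card + 2 :=
    (Finset.card_le_card hsub).trans ((Finset.card_union_le _ _).trans
      (Nat.add_le_add_left Finset.card_le_two _))
  calc _ ≤ L * ((Finset.univ.filter fun x => π x ≠ τ x).card + 2) := Nat.mul_le_mul_left _ hle
    _ ≤ 2 * M := by rw [mul_add]; omega

/-! ### Packing copies of the model actions -/

/-- A permutation all of whose cycles have length `m` is a union of copies of `ZMod m`. -/
theorem Equiv.Perm.exists_equiv_prod_zmod {Y : Type*} [Finite Y] {m : ℕ} [NeZero m]
    (τ : Equiv.Perm Y) (h : ∀ y, Function.minimalPeriod τ y = m) :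
    ∃ e : Quotient (Equiv.Perm.SameCycle.setoid τ) × ZMod m ≃ Y,
      ∀ q j, e (q, j + 1) = τ (e (q, j)) := by
  let f : Quotient (Equiv.Perm.SameCycle.setoid τ) × ZMod m → Y := fun p => τ^[p.2.val] p.1.out
  have hsame : ∀ p, (⟦f p⟧ : Quotient (Equiv.Perm.SameCycle.setoid τ)) = p.1 := fun p => by
    rw [← Quotient.out_eq p.1]
    refine Quotient.sound (s := Equiv.Perm.SameCycle.setoid τ) ?_
    change Equiv.Perm.SameCycle τ _ _
    simp only [f, Equiv.Perm.iterate_eq_pow]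
    exact Equiv.Perm.sameCycle_pow_left.2 (Equiv.Perm.SameCycle.refl _ _)
  have hmod : ∀ (y : Y) (n : ℕ), τ^[n % m] y = τ^[n] y := fun y n => by
    conv_lhs => rw [← h y]
    exact Function.iterate_mod_minimalPeriod_eq
  have hf : Function.Bijective f := by
    constructor
    · rintro ⟨q, j⟩ ⟨q', j'⟩ hqq
      obtain rfl : q = q' := (hsame (q, j)).symm.trans (hqq ▸ hsame (q', j'))
      have : j.val = j'.val := Function.iterate_injOn_Iio_minimalPeriod (f := τ) (x := q.out)
        (by rw [Set.mem_Iio, h]; exact ZMod.val_lt j)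
        (by rw [Set.mem_Iio, h]; exact ZMod.val_lt j') hqq
      rw [ZMod.val_injective m this]
    · intro y
      have : Equiv.Perm.SameCycle τ (⟦y⟧ : Quotient (Equiv.Perm.SameCycle.setoid τ)).out y :=
        Quotient.mk_out (s := Equiv.Perm.SameCycle.setoid τ) y
      obtain ⟨n, hn⟩ := this.exists_nat_pow_eq
      refine ⟨(⟦y⟧, (n : ZMod m)), ?_⟩
      simp only [f, ZMod.val_natCast, hmod]
      rw [Equiv.Perm.iterate_eq_pow, hn]
  refine ⟨Equiv.ofBijective f hf, fun q j => ?_⟩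
  simp only [Equiv.ofBijective_apply, f]
  rw [← Function.iterate_succ_apply' τ, ← hmod _ (j.val + 1), ← ZMod.val_natCast]
  simp

/-- Both sides are unions of `m`-cycles, so comparing sizes compares numbers of cycles. -/
theorem Equiv.Perm.exists_semiconj_embedding {X Y : Type*} [Fintype X] [Fintype Y] {m : ℕ}
    (hm : 0 < m) (ρ : Equiv.Perm X) (τ : Equiv.Perm Y)
    (hρ : ∀ x, Function.minimalPeriod ρ x = m) (hτ : ∀ y, Function.minimalPeriod τ y = m)
    (hXY : Fintype.card X ≤ Fintype.card Y) : ∃ φ : X ↪ Y, ∀ x, φ (ρ x) = τ (φ x) := by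
  classical
  have : NeZero m := ⟨hm.ne'⟩
  obtain ⟨e, he⟩ := ρ.exists_equiv_prod_zmod hρ
  obtain ⟨e', he'⟩ := τ.exists_equiv_prod_zmod hτ
  have := Fintype.ofFinite (Quotient (Equiv.Perm.SameCycle.setoid ρ))
  have := Fintype.ofFinite (Quotient (Equiv.Perm.SameCycle.setoid τ))
  rw [← Fintype.card_congr e, ← Fintype.card_congr e', Fintype.card_prod, Fintype.card_prod,
    ZMod.card] at hXY
  obtain ⟨f⟩ := Function.Embedding.nonempty_of_card_le (Nat.le_of_mul_le_mul_right hXY hm)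
  refine ⟨e.symm.toEmbedding.trans
    ((f.prodMap (Function.Embedding.refl _)).trans e'.toEmbedding), fun x => ?_⟩
  obtain ⟨⟨q, j⟩, rfl⟩ := e.surjective x
  rw [← he]
  simp [← he']

/-- If for every `m ≤ L` an element `w` acts on a set of size at most `D` with all cycles of
length `m`, then any permutation with cycles of length at most `L` agrees with an action of `w`
outside a set of size at most `L * D`. -/
theorem exists_perm_rep_close {F : Type*} [Group F] (w : F) (L D : ℕ)
    (hX : ∀ m, 0 < m → m ≤ L → ∃ (X : Type) (_ : Fintype X) (_ : Nonempty X)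
      (ρ : F →* Equiv.Perm X), Fintype.card X ≤ D ∧ ∀ x, Function.minimalPeriod (ρ w) x = m)
    {Ω : Type*} [Fintype Ω] [DecidableEq Ω] (σ : Equiv.Perm Ω)
    (hσ : ∀ x, Function.minimalPeriod σ x ≤ L) :
    ∃ ρ : F →* Equiv.Perm Ω, (Finset.univ.filter fun x => σ x ≠ ρ w x).card ≤ L * D := by
  classical
  induction hn : Fintype.card Ω using Nat.strong_induction_on generalizing Ω with
  | _ n ih =>
  subst hn
  by_cases hD : ∀ m ∈ Finset.Icc 1 L,
      (Finset.univ.filter fun x => Function.minimalPeriod σ x = m).card ≤ D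
  -- Here `Ω` itself has at most `L * D` points, so the trivial action will do.
  · refine ⟨1, (Finset.card_le_univ _).trans ?_⟩
    rw [← Finset.card_univ, Finset.card_eq_sum_card_fiberwise (f := Function.minimalPeriod σ)
      (t := Finset.Icc 1 L)]
    · exact (Finset.sum_le_card_nsmul _ _ _ hD).trans (by simp)
    · intro x _
      exact Finset.mem_coe.2 (Finset.mem_Icc.2 ⟨Function.minimalPeriod_pos_of_mem_periodicPts
        (σ.injective.mem_periodicPts x), hσ x⟩)
  push Not at hD
  obtain ⟨m, hm, hDm⟩ := hD
  obtain ⟨hm1, hmL⟩ := Finset.mem_Icc.1 hm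
  obtain ⟨X, _, _, ρX, hcX, hpX⟩ := hX m hm1 hmL
  have hinv : ∀ x, Function.minimalPeriod σ (σ x) = m ↔ Function.minimalPeriod σ x = m :=
    fun x => by rw [Function.minimalPeriod_apply (σ.injective.mem_periodicPts x)]
  have hsub : ∀ (p : Ω → Prop) (hp : ∀ x, p (σ x) ↔ p x) (x : {x // p x}),
      Function.minimalPeriod (σ.subtypePerm hp) x = Function.minimalPeriod σ x := by
    intro p hp x
    have : ∀ j, (((σ.subtypePerm hp)^[j] x : {x // p x}) : Ω) = σ^[j] x := fun j =>
      (Function.Semiconj.iterate_right (f := Subtype.val) (ga := σ.subtypePerm hp) (gb := σ)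
        (fun _ => rfl) j) x
    rw [Function.minimalPeriod_eq_minimalPeriod_iff]
    intro j
    rw [Function.IsPeriodicPt, Function.IsFixedPt, Subtype.ext_iff, this]
    rfl
  obtain ⟨φ, hφ⟩ := Equiv.Perm.exists_semiconj_embedding
    (Y := {x // Function.minimalPeriod σ x = m}) hm1 (ρX w) (σ.subtypePerm hinv) hpX
    (fun y => (hsub _ hinv y).trans y.2)
    (by rw [Fintype.card_subtype]; exact hcX.trans hDm.le)
  let ψ : X → Ω := fun x => (φ x).1
  have hψ : Function.Injective ψ := Subtype.val_injective.comp φ.injective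
  have hψσ : ∀ x, ψ (ρX w x) = σ (ψ x) := fun x => by simp [ψ, hφ]
  let p : Ω → Prop := fun y => y ∈ Set.range ψ
  have hp : ∀ y, p (σ y) ↔ p y := by
    refine fun y => ⟨?_, ?_⟩
    · rintro ⟨x, hx⟩
      refine ⟨(ρX w)⁻¹ x, σ.injective ?_⟩
      rw [← hψσ, ← hx]
      simp
    · rintro ⟨x, rfl⟩
      exact ⟨ρX w x, hψσ x⟩
  have hp' : ∀ y, ¬ p (σ y) ↔ ¬ p y := fun y => not_congr (hp y)
  obtain ⟨x₀⟩ := ‹Nonempty X›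
  obtain ⟨ρ', hρ'⟩ := ih (Fintype.card {y // ¬ p y})
    (Fintype.card_subtype_lt (x := ψ x₀) (not_not.2 ⟨x₀, rfl⟩)) (σ.subtypePerm hp')
    (fun y => by rw [hsub]; exact hσ y) rfl
  -- Glue the copy of `X`, where `w` acts exactly as `σ`, to the action found on the complement.
  refine ⟨(Equiv.Perm.subtypeCongrHom p).comp
    (((Equiv.ofInjective ψ hψ).permCongrHom.toMonoidHom.comp ρX).prod ρ'), le_trans ?_ hρ'⟩
  rw [← Finset.card_map (Function.Embedding.subtype fun y => ¬ p y)]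
  apply Finset.card_le_card
  intro y hy
  rw [Finset.mem_filter] at hy
  by_cases hpy : p y
  · obtain ⟨x, rfl⟩ := id hpy
    refine absurd ?_ hy.2
    simp only [MonoidHom.comp_apply, MonoidHom.prod_apply, Equiv.Perm.subtypeCongrHom_apply]
    rw [Equiv.Perm.subtypeCongr.left_apply _ _ hpy, ← hψσ]
    change _ = (Equiv.ofInjective ψ hψ (ρX w ((Equiv.ofInjective ψ hψ).symm
      (Equiv.ofInjective ψ hψ x)))).1
    rw [Equiv.symm_apply_apply, Equiv.ofInjective_apply]
  · refine Finset.mem_map.2 ⟨⟨y, hpy⟩, Finset.mem_filter.2 ⟨Finset.mem_univ _, fun heq => hy.2 ?_⟩,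
      rfl⟩
    simp only [MonoidHom.comp_apply, MonoidHom.prod_apply, Equiv.Perm.subtypeCongrHom_apply]
    rw [Equiv.Perm.subtypeCongr.right_apply _ _ hpy, ← heq]
    rfl

/-! ### Quantitative density -/

theorem distToSet_wordImage_le {k : ℕ} (w : FreeGroup (Fin k)) {n : ℕ}
    (σ : Equiv.Perm (Fin n)) (ρ : FreeGroup (Fin k) →* Equiv.Perm (Fin n)) :
    distToSet normHammingDist σ (wordImage w (Equiv.Perm (Fin n))) ≤
      ((Finset.univ.filter fun x => σ x ≠ ρ w x).card : ℝ) / n := by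
  have hmem : ρ w ∈ wordImage w (Equiv.Perm (Fin n)) := by
    refine ⟨fun i => ρ (FreeGroup.of i), ?_⟩
    rw [wordMap]
    exact (DFunLike.congr_fun (FreeGroup.lift.apply_symm_apply ρ) w)
  exact ciInf_le ⟨0, by rintro _ ⟨τ, rfl⟩; exact normHammingDist_nonneg _ _⟩
    (⟨ρ w, hmem⟩ : wordImage w (Equiv.Perm (Fin n)))

/-- Word images in symmetric groups approximate every permutation, up to cutting cycles at
length `L` and a remainder polynomial in `L`. -/
theorem exists_distToSet_wordImage_le {k : ℕ} {w : FreeGroup (Fin k)} (hw : w ≠ 1) :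
    ∃ b a : ℕ, ∀ L n : ℕ, 0 < L → 0 < n → ∀ σ : Equiv.Perm (Fin n),
      distToSet normHammingDist σ (wordImage w (Equiv.Perm (Fin n))) ≤
        2 / L + L * (L * a : ℝ) ^ b / n := by
  obtain ⟨b, a, -, h⟩ := exists_perm_rep_minimalPeriod hw
  refine ⟨b, a, fun L n hL hn σ => ?_⟩
  obtain ⟨τ, hτ, hd⟩ := σ.exists_minimalPeriod_le hL
  obtain ⟨ρ, hρ⟩ := exists_perm_rep_close w L ((L * a) ^ b) (fun m hm hmL => by
    obtain ⟨X, i, j, ρ, hc, hp⟩ := h m hm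
    exact ⟨X, i, j, ρ, hc.trans (Nat.pow_le_pow_left (Nat.mul_le_mul_right a hmL) b), hp⟩) τ hτ
  refine (distToSet_wordImage_le w σ ρ).trans ?_
  have h1 : (Finset.univ.filter fun x => σ x ≠ ρ w x).card ≤
      (Finset.univ.filter fun x => σ x ≠ τ x).card +
        (Finset.univ.filter fun x => τ x ≠ ρ w x).card := by
    refine (Finset.card_le_card fun x hx => ?_).trans (Finset.card_union_le _ _)
    simp only [Finset.mem_filter, Finset.mem_univ, true_and, Finset.mem_union] at hx ⊢
    by_contra hcon
    push Not at hcon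
    exact hx (hcon.1.trans hcon.2)
  have h2 : (L : ℝ) * (Finset.univ.filter fun x => σ x ≠ τ x).card ≤ 2 * n := by
    have := hd.trans (Nat.mul_le_mul_left 2 (Finset.card_le_univ _))
    rw [Fintype.card_fin] at this
    exact_mod_cast this
  have h3 : ((Finset.univ.filter fun x => τ x ≠ ρ w x).card : ℝ) ≤ L * (L * a : ℝ) ^ b := by
    exact_mod_cast hρ
  have hn' : (0 : ℝ) < n := by exact_mod_cast hn
  have hL' : (0 : ℝ) < L := by exact_mod_cast hL
  have h4 : ((Finset.univ.filter fun x => σ x ≠ τ x).card : ℝ) / n ≤ 2 / L := by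
    rw [div_le_div_iff₀ hn' hL']
    linarith
  calc _ ≤ (((Finset.univ.filter fun x => σ x ≠ τ x).card : ℝ) +
        (Finset.univ.filter fun x => τ x ≠ ρ w x).card) / n := by
        gcongr; exact_mod_cast h1
    _ ≤ _ := by rw [add_div]; gcongr

/-- The terms `1 / L` and `L ^ (b + 1) / n` balance at `L ≈ n ^ (1 / (b + 2))`, hence `e = b + 2`.
Rounding up costs at most a factor `2` in `L`, whence the `2 ^ (b + 1)` in `C`. -/
theorem exists_distToSet_wordImage_le_rpow {k : ℕ} {w : FreeGroup (Fin k)} (hw : w ≠ 1) :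
    ∃ e : ℝ, 1 ≤ e ∧ ∃ C : ℝ, 0 < C ∧ ∀ n : ℕ, 1 ≤ n → ∀ σ : Equiv.Perm (Fin n),
      distToSet normHammingDist σ (wordImage w (Equiv.Perm (Fin n))) ≤
        C * (n : ℝ) ^ (-(1 / e)) := by
  obtain ⟨b, a, h⟩ := exists_distToSet_wordImage_le hw
  refine ⟨b + 2, by linarith [(Nat.cast_nonneg b : (0 : ℝ) ≤ b)], 2 + 2 ^ (b + 1) * a ^ b,
    by positivity, fun n hn σ => ?_⟩
  have hn1 : (1 : ℝ) ≤ n := by exact_mod_cast hn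
  set y : ℝ := (n : ℝ) ^ (1 / (b + 2 : ℝ)) with hy
  have hy1 : 1 ≤ y := Real.one_le_rpow hn1 (by positivity)
  have hyn : y ^ (b + 2) = n := by
    rw [hy, ← Real.rpow_natCast, ← Real.rpow_mul (by linarith)]
    push_cast
    rw [one_div_mul_cancel (by positivity), Real.rpow_one]
  rw [Real.rpow_neg (by linarith), ← hy]
  have hL : 0 < ⌈y⌉₊ := Nat.ceil_pos.2 (by linarith)
  have hLy : y ≤ ⌈y⌉₊ := Nat.le_ceil y
  have hLy2 : (⌈y⌉₊ : ℝ) ≤ 2 * y := by linarith [Nat.ceil_lt_add_one (by linarith : 0 ≤ y)]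
  refine (h ⌈y⌉₊ n hL hn σ).trans ?_
  rw [← hyn]
  calc 2 / (⌈y⌉₊ : ℝ) + ⌈y⌉₊ * (⌈y⌉₊ * a : ℝ) ^ b / y ^ (b + 2)
      ≤ 2 / y + (2 * y) * (2 * y * a) ^ b / y ^ (b + 2) := by gcongr
    _ = (2 + 2 ^ (b + 1) * a ^ b) * y⁻¹ := by
      have : y ≠ 0 := by positivity
      field_simp
      ring

theorem theorem1p1 {k : ℕ} (w : FreeGroup (Fin k)) (hw : w ≠ 1) :
    (∀ ε : ℝ, 0 < ε → ∃ N : ℕ, ∀ n : ℕ, N ≤ n →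
      IsEpsDense (normHammingDist (n := n)) ε (wordImage w (Equiv.Perm (Fin n)))) ∧
    (∃ e : ℝ, 1 ≤ e ∧ ∃ C : ℝ, 0 < C ∧ ∀ n : ℕ, 1 ≤ n → ∀ σ : Equiv.Perm (Fin n),
      distToSet normHammingDist σ (wordImage w (Equiv.Perm (Fin n))) ≤
        C * (n : ℝ) ^ (-(1 / e))) := by
  have hrate := exists_distToSet_wordImage_le_rpow hw
  refine ⟨fun ε hε => ?_, hrate⟩
  obtain ⟨e, he, C, hC, h⟩ := hrate
  have hlim : Filter.Tendsto (fun n : ℕ => C * (n : ℝ) ^ (-(1 / e))) Filter.atTop (nhds 0) := by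
    have := ((tendsto_rpow_neg_atTop (by positivity : 0 < 1 / e)).comp
      tendsto_natCast_atTop_atTop).const_mul C
    rwa [mul_zero] at this
  obtain ⟨N, hN⟩ := Filter.eventually_atTop.1 (hlim.eventually_le_const hε)
  exact ⟨max N 1, fun n hn σ => (h n (le_of_max_le_right hn) σ).trans
    (hN n (le_of_max_le_left hn))⟩
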